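/- Let $F_0=0$, $F_1=1$, $F_k=F_{k-1}+F_{k-2}$ for $k\ge 2$, and let ${\bf f}=01001010\cdots$ be the infinite Fibonacci word, i.e. the characteristic Sturmian word of slope $\alpha=(3-\sqrt5)/2$: indexing from $0$, ${\bf f}[k]=\lfloor (k+2)\alpha\rfloor-\lfloor (k+1)\alpha\rfloor$ for $k\ge 0$. A period of a finite word $w$ of length $m$ is an integer $p$ with $1\le p\le m$ such that $w[i]=w[i+p]$ whenever both positions lie in $w$; the trivial period $m$ is included. A lazy Fibonacci representation of an integer $n\ge 1$ is an expression $n=F_{t_1}+\cdots+F_{t_r}$ with $2\le t_1<t_2<\cdots<t_r$ such that the string of digits $d_{t_r}d_{t_r-1}\cdots d_2$, where $d_i=1$ if $i\in\{t_1,\ldots,t_r\}$ and $d_i=0$ otherwise, contains no two consecutive $0$'s. Then: (a) Every integer $n\ge 1$ has exactly one lazy Fibonacci representation, and if it is $n=F_{t_1}+F_{t_2}+\cdots+F_{t_r}$ with $t_1<t_2<\cdots<t_r$, then the periods of the length-$n$ prefix of ${\bf f}$ are precisely $$F_{t_r},\ F_{t_r}+F_{t_{r-1}},\ F_{t_r}+F_{t_{r-1}}+F_{t_{r-2}},\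 \ldots,\ F_{t_r}+F_{t_{r-1}}+\cdots+F_{t_1}.$$ (b) For every $n\ge 1$, the shortest prefix of ${\bf f}$ having exactly $n$ periods (including the trivial one) has length $F_{n+3}-2$. (c) For every $n\ge 1$, the longest prefix of ${\bf f}$ having exactly $n$ periods (including the trivial one) has length $F_{2n+2}-1$. (d) For every $n\ge 2$ and every $m$ with $F_{n+1}-1\le m\le F_{n+2}-2$, the least period of ${\bf f}[0..m-1]$ is $F_n$. -/

import Mathlib

/-- The characteristic Sturmian word of slope `α`: its `i`-th letter, for `i ≥ 1`, is
`⌊(i + 1) α⌋ - ⌊i α⌋`. -/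
noncomputable def sturmianCharWord (α : ℝ) (i : ℕ) : ℤ :=
  ⌊((i : ℝ) + 1) * α⌋ - ⌊(i : ℝ) * α⌋

/-- The infinite Fibonacci word `01001010⋯`, indexed from `0`: the characteristic Sturmian word
(whose first letter has index `1`) of slope `(3 - √5) / 2`. -/
noncomputable def fibonacciWord (k : ℕ) : ℤ :=
  sturmianCharWord ((3 - Real.sqrt 5) / 2) (k + 1)

/-- The prefix `f[0..m-1]` of length `m` of the Fibonacci word. -/
noncomputable def fibonacciPrefix (m : ℕ) : List ℤ :=
  (List.range m).map fibonacciWord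

/-- The periods of a finite word `w`: the integers `1 ≤ p ≤ |w|` such that `w[i] = w[i + p]`
whenever both sides are defined. The trivial period `|w|` of a nonempty word is included. -/
def wordPeriods {A : Type*} (w : List A) : Set ℕ :=
  {p | 1 ≤ p ∧ p ≤ w.length ∧ w.HasPeriod p}

/-- `S` is the set of indices `{t₁ < ⋯ < t_r}` of a lazy Fibonacci representation of `n`:
all indices are at least `2`, the sum of the `F_t`, `t ∈ S`, is `n`, and the digit string
from position `max S` (most significant digit) down to position `2` has no two consecutive `0`s. -/
structure IsLazyFibRep (n : ℕ) (S : Finset ℕ) : Prop where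
  two_le : ∀ t ∈ S, 2 ≤ t
  sum_eq : ∑ t ∈ S, Nat.fib t = n
  no_two_zeros : ∀ i, 2 ≤ i → (∃ t ∈ S, i + 1 ≤ t) → i ∈ S ∨ i + 1 ∈ S

/-! With ψ = `Real.goldenConj`, the slope is 1 + ψ, and F_{s+1}ψ = ψ^{s+1} - F_s is nearly an
integer. So a shift by F_{s+1} preserves the letters of the word until an explicit first mismatch
(`fibonacciWord_add_fib`, `fibonacciWord_add_fib_ne`). Hence the least period is F_k exactly on the
block F_{k+1} - 1 ≤ m ≤ F_{k+2} - 2, and these blocks partition m ≥ 1. The other periods are F_k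
plus the periods of the prefix of length m - F_k. A lazy representation of m in block k has largest
index k, and deleting it leaves a lazy representation of m - F_k. Both sides obey the same
recursion, which gives (a). The extremal lengths in (b) and (c) come from the digit strings 11…1 and
1010…10. -/

/-! ### Floors of multiples of ψ. -/

/-- Every integer vector is an integer combination of two consecutive Fibonacci vectors. -/
theorem exists_fib_combination (j b : ℤ) (s : ℕ) :
    ∃ x y : ℤ, j = x * Nat.fib (s + 1) + y * Nat.fib (s + 2) ∧
      b = x * Nat.fib s + y * Nat.fib (s + 1) := by
  induction s with
  | zero => exact ⟨j - b, b, by simp, by simp⟩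
  | succ s ih =>
    obtain ⟨x, y, hj, hb⟩ := ih
    refine ⟨y - x, x, ?_, ?_⟩
    · rw [hj, show s + 1 + 2 = s + 1 + 1 + 1 from rfl, Nat.fib_add_two (n := s + 1)]
      push_cast
      ring
    · rw [hb, show s + 1 + 1 = s + 2 from rfl, Nat.fib_add_two (n := s)]
      push_cast
      ring

theorem goldenConj_bounds : -(2 / 3) < Real.goldenConj ∧ Real.goldenConj < -(1 / 2) := by
  have h1 := Real.goldenConj_sq
  have h2 := Real.goldenConj_neg
  constructor <;> nlinarith

/-- As -1 < ψ < 0, the bounds on x + yψ force x and y to be both nonpositive, or x ≥ 0 and y ≥ 1;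
then xA + yB is ≤ 0 or ≥ B. -/
theorem not_lt_fib_of_conj_mem_Icc {x y A B : ℤ} (hA : 0 ≤ A) (hB : 0 ≤ B)
    (hlo : 0 < x * A + y * B) (hhi : x * A + y * B < B)
    (h1 : -1 ≤ (x : ℝ) + y * Real.goldenConj) (h2 : (x : ℝ) + y * Real.goldenConj ≤ 0) :
    False := by
  obtain ⟨hψ1, hψ2⟩ := goldenConj_bounds
  rcases lt_trichotomy y 0 with hy | rfl | hy
  · have hx : x ≤ 0 := by
      have hy' : (y : ℝ) ≤ 0 := by exact_mod_cast hy.le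
      have : (x : ℝ) ≤ 0 := by nlinarith
      exact_mod_cast this
    nlinarith
  · have hx : x ≤ 0 := by
      have : (x : ℝ) ≤ 0 := by simpa using h2
      exact_mod_cast this
    nlinarith
  · have hx : 0 ≤ x := by
      have hy' : (1 : ℝ) ≤ y := by exact_mod_cast hy
      have : (-1 : ℝ) < x := by nlinarith
      have : (-1 : ℤ) < x := by exact_mod_cast this
      omega
    nlinarith

theorem fib_succ_mul_goldenConj (s : ℕ) :
    (Nat.fib (s + 1) : ℝ) * Real.goldenConj = Real.goldenConj ^ (s + 1) - Nat.fib s := by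
  rw [← Real.goldenConj_mul_fib_succ_add_fib]
  ring

theorem floor_mul_goldenConj_add_pow {s j : ℕ} (hj : 1 ≤ j) (hj' : j < Nat.fib (s + 2)) :
    ⌊(j : ℝ) * Real.goldenConj + Real.goldenConj ^ (s + 1)⌋ = ⌊(j : ℝ) * Real.goldenConj⌋ := by
  by_contra hne
  set ψ := Real.goldenConj with hψ
  -- In Fibonacci coordinates, b + jψ = ψ^{s+1}(x + yψ). An integer -b separating jψ from jψ +
  -- ψ^{s+1} would put u = x + yψ in [-1, 0].
  have key : ∀ b : ℤ, ∃ u : ℝ, (b : ℝ) + j * ψ = ψ ^ (s + 1) * u ∧ (-1 ≤ u → u ≤ 0 → False) := by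
    intro b
    obtain ⟨x, y, hx, hy⟩ := exists_fib_combination j b s
    refine ⟨x + y * ψ, ?_, fun h1 h2 => ?_⟩
    · have e1 := Real.goldenConj_mul_fib_succ_add_fib s
      have e2 := Real.goldenConj_mul_fib_succ_add_fib (s + 1)
      rw [← hψ] at e1 e2
      have hx' : (j : ℝ) = x * Nat.fib (s + 1) + y * Nat.fib (s + 2) := by exact_mod_cast hx
      have hy' : (b : ℝ) = x * Nat.fib s + y * Nat.fib (s + 1) := by exact_mod_cast hy
      have e3 : ψ ^ (s + 1 + 1) = ψ ^ (s + 1) * ψ := pow_succ _ _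
      rw [hx', hy']
      linear_combination (x : ℝ) * e1 + y * e2 + y * e3
    · exact not_lt_fib_of_conj_mem_Icc (A := Nat.fib (s + 1)) (B := Nat.fib (s + 2)) (by positivity)
        (by positivity) (by rw [← hx]; exact_mod_cast hj) (by rw [← hx]; exact_mod_cast hj') h1 h2
  have hψ0 : ψ ^ (s + 1) ≠ 0 := pow_ne_zero _ Real.goldenConj_ne_zero
  rcases lt_or_gt_of_ne hψ0 with he | he
  · have hlt : ⌊(j : ℝ) * ψ + ψ ^ (s + 1)⌋ < ⌊(j : ℝ) * ψ⌋ :=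
      lt_of_le_of_ne (Int.floor_le_floor (by linarith)) hne
    obtain ⟨u, hu, hf⟩ := key (-⌊(j : ℝ) * ψ⌋)
    push_cast at hu
    have h1 := Int.floor_lt.1 hlt
    have h2 := Int.floor_le ((j : ℝ) * ψ)
    exact hf (by nlinarith) (by nlinarith)
  · have hlt : ⌊(j : ℝ) * ψ⌋ < ⌊(j : ℝ) * ψ + ψ ^ (s + 1)⌋ :=
      lt_of_le_of_ne (Int.floor_le_floor (by linarith)) (Ne.symm hne)
    obtain ⟨u, hu, hf⟩ := key (-⌊(j : ℝ) * ψ + ψ ^ (s + 1)⌋)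
    push_cast at hu
    have h1 := Int.floor_lt.1 hlt
    have h2 := Int.floor_le ((j : ℝ) * ψ + ψ ^ (s + 1))
    exact hf (by nlinarith) (by nlinarith)

theorem floor_add_fib_mul_goldenConj {s j : ℕ} (hj : 1 ≤ j) (hj' : j < Nat.fib (s + 2)) :
    ⌊((j + Nat.fib (s + 1) : ℕ) : ℝ) * Real.goldenConj⌋ =
      ⌊(j : ℝ) * Real.goldenConj⌋ - Nat.fib s := by
  rw [← floor_mul_goldenConj_add_pow hj hj', ← Int.floor_sub_natCast]
  congr 1
  push_cast
  linear_combination fib_succ_mul_goldenConj s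

theorem floor_fib_succ_mul_goldenConj (s : ℕ) :
    ⌊(Nat.fib (s + 1) : ℝ) * Real.goldenConj⌋ = ⌊Real.goldenConj ^ (s + 1)⌋ - Nat.fib s := by
  rw [fib_succ_mul_goldenConj, Int.floor_sub_natCast]

/-- Consecutive powers of ψ have opposite signs; this produces the mismatch in
`fibonacciWord_add_fib_ne`. -/
theorem floor_goldenConj_pow_succ_ne (s : ℕ) :
    ⌊Real.goldenConj ^ (s + 1)⌋ ≠ ⌊Real.goldenConj ^ s⌋ := by
  have hψ := Real.goldenConj_neg
  have hψ0 : Real.goldenConj ^ s ≠ 0 := pow_ne_zero _ Real.goldenConj_ne_zero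
  intro h
  rcases lt_or_gt_of_ne hψ0 with he | he
  · have h1 : 0 ≤ ⌊Real.goldenConj ^ (s + 1)⌋ :=
      Int.floor_nonneg.2 (by rw [pow_succ]; exact (mul_pos_of_neg_of_neg he hψ).le)
    have h2 : ⌊Real.goldenConj ^ s⌋ < 0 := Int.floor_lt.2 (by simpa using he)
    omega
  · have h1 : ⌊Real.goldenConj ^ (s + 1)⌋ < 0 :=
      Int.floor_lt.2 (by rw [pow_succ]; simpa using mul_neg_of_pos_of_neg he hψ)
    have h2 : 0 ≤ ⌊Real.goldenConj ^ s⌋ := Int.floor_nonneg.2 he.le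
    omega

/-! ### Fibonacci shifts of the word and periods of its prefixes. -/

theorem fibonacciWord_eq_floor_goldenConj (k : ℕ) :
    fibonacciWord k =
      ⌊((k + 2 : ℕ) : ℝ) * Real.goldenConj⌋ - ⌊((k + 1 : ℕ) : ℝ) * Real.goldenConj⌋ + 1 := by
  have h : ∀ j : ℕ, ⌊(j : ℝ) * ((3 - Real.sqrt 5) / 2)⌋ = ⌊(j : ℝ) * Real.goldenConj⌋ + j := by
    intro j
    rw [← Int.floor_add_natCast]
    congr 1
    rw [Real.goldenConj]
    ring
  have h1 := h (k + 1)
  have h2 := h (k + 2)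
  rw [fibonacciWord, sturmianCharWord, h1,
    show ((k + 1 : ℕ) : ℝ) + 1 = ((k + 2 : ℕ) : ℝ) by push_cast; ring, h2]
  push_cast
  ring

theorem fibonacciWord_add_fib {s i : ℕ} (hi : i + 2 < Nat.fib (s + 2)) :
    fibonacciWord (i + Nat.fib (s + 1)) = fibonacciWord i := by
  have h1 := floor_add_fib_mul_goldenConj (s := s) (j := i + 1) (by omega) (by omega)
  have h2 := floor_add_fib_mul_goldenConj (s := s) (j := i + 2) (by omega) (by omega)
  rw [fibonacciWord_eq_floor_goldenConj, fibonacciWord_eq_floor_goldenConj,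
    add_right_comm i (Nat.fib (s + 1)) 2, add_right_comm i (Nat.fib (s + 1)) 1, h1, h2]
  ring

theorem fibonacciWord_add_fib_ne {s i : ℕ} (hi : i + 2 = Nat.fib (s + 2)) :
    fibonacciWord (i + Nat.fib (s + 1)) ≠ fibonacciWord i := by
  have h1 := floor_add_fib_mul_goldenConj (s := s) (j := i + 1) (by omega) (by omega)
  have h2 := floor_fib_succ_mul_goldenConj (s + 1)
  have h3 := floor_fib_succ_mul_goldenConj (s + 2)
  have h4 := floor_goldenConj_pow_succ_ne (s + 2)
  have h5 : Nat.fib (s + 2) = Nat.fib s + Nat.fib (s + 1) := Nat.fib_add_two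
  have h6 : i + 2 + Nat.fib (s + 1) = Nat.fib (s + 2 + 1) := by
    rw [hi, show s + 2 + 1 = s + 1 + 2 from rfl, Nat.fib_add_two (n := s + 1), add_comm]
  rw [fibonacciWord_eq_floor_goldenConj, fibonacciWord_eq_floor_goldenConj,
    add_right_comm i (Nat.fib (s + 1)) 2, add_right_comm i (Nat.fib (s + 1)) 1, h1, h6, hi, h3, h2]
  rw [h5]
  push_cast
  intro h
  apply h4
  linarith

theorem mem_wordPeriods_fibonacciPrefix {m p : ℕ} :
    p ∈ wordPeriods (fibonacciPrefix m) ↔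
      1 ≤ p ∧ p ≤ m ∧ ∀ i, i + p < m → fibonacciWord i = fibonacciWord (i + p) := by
  have hlen : (fibonacciPrefix m).length = m := by simp [fibonacciPrefix]
  have hget : ∀ i < m, (fibonacciPrefix m)[i]? = some (fibonacciWord i) := by
    intro i hi
    simp [fibonacciPrefix, hi]
  rw [wordPeriods, Set.mem_ofPred_eq, hlen, List.hasPeriod_iff_getElem?, hlen]
  refine and_congr_right fun _ => and_congr_right fun _ => forall_congr' fun i => ?_
  refine ⟨fun h hi => ?_, fun h hi => ?_⟩
  · have := h (by omega)
    rw [hget _ (by omega), hget _ (by omega)] at this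
    exact Option.some.inj this
  · rw [hget _ (by omega), hget _ (by omega), h (by omega)]

theorem fib_succ_le_of_forall_eq (n : ℕ) : ∀ {m p : ℕ}, Nat.fib (n + 2) ≤ m + 1 → 1 ≤ p →
    (∀ i, i + p < m → fibonacciWord i = fibonacciWord (i + p)) → Nat.fib (n + 1) ≤ p := by
  induction n using Nat.strong_induction_on with
  | _ n ih =>
    intro m p hm hp hper
    match n with
    | 0 => simpa using hp
    | 1 => simpa using hp
    | n + 2 =>
      have e2 : Nat.fib (n + 3) = Nat.fib (n + 1) + Nat.fib (n + 2) := Nat.fib_add_two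
      have e3 : Nat.fib (n + 4) = Nat.fib (n + 2) + Nat.fib (n + 3) := Nat.fib_add_two
      have p1 : 0 < Nat.fib (n + 1) := Nat.fib_pos.2 (by omega)
      have p2 : 0 < Nat.fib (n + 2) := Nat.fib_pos.2 (by omega)
      change Nat.fib (n + 4) ≤ m + 1 at hm
      change Nat.fib (n + 3) ≤ p
      by_contra! hlt
      have h1 : Nat.fib (n + 2) ≤ p :=
        @ih (n + 1) (by omega) m p (by change Nat.fib (n + 3) ≤ m + 1; omega) hp hper
      rcases h1.eq_or_lt with h1 | h1
      -- The mismatch for the shift F_{n+2} sits at position F_{n+4} - 2, inside the prefix.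
      · have := fibonacciWord_add_fib_ne (s := n + 1) (i := Nat.fib (n + 3) - 2)
          (by change _ = Nat.fib (n + 3); omega)
        apply this
        change fibonacciWord (_ + Nat.fib (n + 2)) = _
        rw [h1]
        exact (hper _ (by omega)).symm
      -- Undoing a shift by F_{n+2} makes p - F_{n+2} a period of the prefix of length F_{n+2} - 1,
      -- so it is at least F_{n+1}.
      · have := @ih n (by omega) (Nat.fib (n + 2) - 1) (p - Nat.fib (n + 2)) (by omega)
          (by omega) fun i hi => by
            rw [← fibonacciWord_add_fib (s := n + 1) (i := i + (p - Nat.fib (n + 2)))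
              (by change _ < Nat.fib (n + 3); omega)]
            rw [hper i (by omega)]
            congr 1
            change _ = _ + Nat.fib (n + 2)
            omega
        omega

theorem isLeast_wordPeriods_fibonacciPrefix {k m : ℕ} (hk : 2 ≤ k)
    (h1 : Nat.fib (k + 1) ≤ m + 1) (h2 : m + 2 ≤ Nat.fib (k + 2)) :
    IsLeast (wordPeriods (fibonacciPrefix m)) (Nat.fib k) := by
  obtain ⟨n, rfl⟩ : ∃ n, k = n + 1 := ⟨k - 1, by omega⟩
  have e1 : Nat.fib (n + 1 + 1) = Nat.fib n + Nat.fib (n + 1) := Nat.fib_add_two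
  have e2 : Nat.fib (n + 1 + 2) = Nat.fib (n + 1) + Nat.fib (n + 1 + 1) := Nat.fib_add_two
  have p1 : 0 < Nat.fib (n + 1) := Nat.fib_pos.2 (by omega)
  have p2 : 0 < Nat.fib n := Nat.fib_pos.2 (by omega)
  refine ⟨mem_wordPeriods_fibonacciPrefix.2 ⟨p1, by omega, fun i hi => ?_⟩, fun p hp => ?_⟩
  · exact (fibonacciWord_add_fib (by change _ < Nat.fib (n + 1 + 1); omega)).symm
  · obtain ⟨hp1, -, hp3⟩ := mem_wordPeriods_fibonacciPrefix.1 hp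
    exact fib_succ_le_of_forall_eq n h1 hp1 hp3

/-- Deleting the first q letters leaves the prefix of length m - q, so a period p > q amounts to a
period p - q of that prefix. -/
theorem wordPeriods_fibonacciPrefix_eq_insert {m q : ℕ}
    (h : IsLeast (wordPeriods (fibonacciPrefix m)) q) :
    wordPeriods (fibonacciPrefix m) =
      insert q ((q + ·) '' wordPeriods (fibonacciPrefix (m - q))) := by
  obtain ⟨hq1, hq2, hq3⟩ := mem_wordPeriods_fibonacciPrefix.1 h.1
  ext p
  simp only [Set.mem_insert_iff, Set.mem_image, mem_wordPeriods_fibonacciPrefix]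
  constructor
  · intro hp
    rcases (h.2 (mem_wordPeriods_fibonacciPrefix.2 hp)).eq_or_lt with hqp | hqp
    · exact Or.inl hqp.symm
    · obtain ⟨hp1, hp2, hp3⟩ := hp
      refine Or.inr ⟨p - q, ⟨by omega, by omega, fun i hi => ?_⟩, by omega⟩
      rw [hq3 (i + (p - q)) (by omega), hp3 i (by omega)]
      congr 1
      omega
  · rintro (rfl | ⟨r, ⟨hr1, hr2, hr3⟩, rfl⟩)
    · exact ⟨hq1, hq2, hq3⟩
    · refine ⟨by omega, by omega, fun i hi => ?_⟩
      rw [hr3 i (by omega), hq3 (i + r) (by omega)]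
      congr 1
      omega

theorem exists_fib_block {m : ℕ} (hm : 1 ≤ m) :
    ∃ k, 2 ≤ k ∧ Nat.fib (k + 1) ≤ m + 1 ∧ m + 2 ≤ Nat.fib (k + 2) := by
  have hle : 2 ≤ Nat.greatestFib (m + 1) - 1 := by
    have : 3 ≤ Nat.greatestFib (m + 1) := Nat.le_greatestFib.2 (by
      change 2 ≤ m + 1
      omega)
    omega
  refine ⟨Nat.greatestFib (m + 1) - 1, hle, ?_, ?_⟩
  · rw [show Nat.greatestFib (m + 1) - 1 + 1 = Nat.greatestFib (m + 1) by omega]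
    exact Nat.fib_greatestFib_le _
  · rw [show Nat.greatestFib (m + 1) - 1 + 2 = Nat.greatestFib (m + 1) + 1 by omega]
    exact Nat.lt_fib_greatestFib_add_one _

/-! ### Lazy representations and their link with periods. -/

theorem sum_fib_add_two_le {S : Finset ℕ} (h2 : ∀ t ∈ S, 2 ≤ t) (k : ℕ) (hk : 1 ≤ k) :
    (∀ t ∈ S, t ≤ k) → ∑ t ∈ S, Nat.fib t + 2 ≤ Nat.fib (k + 2) := by
  have key : ∀ k, 1 ≤ k → ∑ t ∈ Finset.Icc 2 k, Nat.fib t + 2 = Nat.fib (k + 2) := by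
    intro k hk
    induction k, hk using Nat.le_induction with
    | base => rfl
    | succ k hk ih =>
      rw [Finset.sum_Icc_succ_top (by omega), show k + 1 + 2 = k + 1 + 1 + 1 from rfl,
        Nat.fib_add_two (n := k + 1), ← ih]
      ring
  intro hS
  rw [← key k hk]
  gcongr
  intro t ht
  exact Finset.mem_Icc.2 ⟨h2 t ht, hS t ht⟩

theorem IsLazyFibRep.erase_max {n k : ℕ} {S : Finset ℕ} (h : IsLazyFibRep n S) (hk : k ∈ S)
    (hmax : ∀ t ∈ S, t ≤ k) : IsLazyFibRep (n - Nat.fib k) (S.erase k) where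
  two_le t ht := h.two_le t (Finset.mem_of_mem_erase ht)
  sum_eq := by
    have := Finset.add_sum_erase S Nat.fib hk
    rw [h.sum_eq] at this
    omega
  no_two_zeros i hi := by
    rintro ⟨t, ht, hit⟩
    have htk := hmax t (Finset.mem_of_mem_erase ht)
    have hne := Finset.ne_of_mem_erase ht
    rcases h.no_two_zeros i hi ⟨t, Finset.mem_of_mem_erase ht, hit⟩ with h1 | h1
    · exact Or.inl (Finset.mem_erase.2 ⟨by omega, h1⟩)
    · exact Or.inr (Finset.mem_erase.2 ⟨by omega, h1⟩)

/-- The sparsest lazy string is 1010…; with `sum_fib_add_two_le`, this places n in the block of its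
largest index. -/
theorem IsLazyFibRep.fib_succ_le (k : ℕ) : ∀ {n : ℕ} {S : Finset ℕ}, IsLazyFibRep n S → k ∈ S →
    (∀ t ∈ S, t ≤ k) → Nat.fib (k + 1) ≤ n + 1 := by
  induction k using Nat.strong_induction_on with
  | _ k ih =>
    intro n S h hk hmax
    have hk2 := h.two_le k hk
    have hsum := Finset.add_sum_erase S Nat.fib hk
    rw [h.sum_eq] at hsum
    match k with
    | 2 =>
      change 2 ≤ n + 1
      simp at hsum
      omega
    | 3 =>
      change 3 ≤ n + 1
      have : Nat.fib 3 = 2 := rfl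
      omega
    | k + 4 =>
      have h' := h.erase_max hk hmax
      have e1 : Nat.fib (k + 4 + 1) = Nat.fib (k + 3) + Nat.fib (k + 4) := Nat.fib_add_two
      have e2 : Nat.fib (k + 4) = Nat.fib (k + 2) + Nat.fib (k + 3) := Nat.fib_add_two
      by_cases h3 : k + 3 ∈ S
      · have := ih (k + 3) (by omega) h' (Finset.mem_erase.2 ⟨by omega, h3⟩) fun t ht => by
          have := hmax t (Finset.mem_of_mem_erase ht)
          have := Finset.ne_of_mem_erase ht
          omega
        change Nat.fib (k + 4) ≤ _ at this
        omega
      · have h4 : k + 2 ∈ S :=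
          (h.no_two_zeros (k + 2) (by omega) ⟨k + 4, hk, by omega⟩).resolve_right h3
        have := ih (k + 2) (by omega) h' (Finset.mem_erase.2 ⟨by omega, h4⟩) fun t ht => by
          have := hmax t (Finset.mem_of_mem_erase ht)
          have := Finset.ne_of_mem_erase ht
          have : t ≠ k + 3 := fun hh => h3 (hh ▸ Finset.mem_of_mem_erase ht)
          omega
        change Nat.fib (k + 3) ≤ _ at this
        omega

theorem fib_block_unique {m k l : ℕ} (h1 : Nat.fib (k + 1) ≤ m + 1) (h2 : m + 2 ≤ Nat.fib (k + 2))
    (h3 : Nat.fib (l + 1) ≤ m + 1) (h4 : m + 2 ≤ Nat.fib (l + 2)) : k = l := by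
  rcases lt_trichotomy k l with h | h | h
  · have := Nat.fib_mono (show k + 2 ≤ l + 1 by omega)
    omega
  · exact h
  · have := Nat.fib_mono (show l + 2 ≤ k + 1 by omega)
    omega

theorem IsLazyFibRep.mem_and_le_of_fib_block {m k : ℕ} {S : Finset ℕ} (h : IsLazyFibRep m S)
    (hk : 2 ≤ k) (h1 : Nat.fib (k + 1) ≤ m + 1) (h2 : m + 2 ≤ Nat.fib (k + 2)) :
    k ∈ S ∧ ∀ t ∈ S, t ≤ k := by
  have hne : S.Nonempty := by
    rw [Finset.nonempty_iff_ne_empty]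
    rintro rfl
    have h0 := h.sum_eq
    have := Nat.fib_mono (show 3 ≤ k + 1 by omega)
    rw [show Nat.fib 3 = 2 from rfl] at this
    simp at h0
    omega
  have hmem := S.max'_mem hne
  have hmax : ∀ t ∈ S, t ≤ S.max' hne := fun t ht => S.le_max' t ht
  have h3 := fib_succ_le _ h hmem hmax
  have h4 := sum_fib_add_two_le h.two_le _ (by have := h.two_le _ hmem; omega) hmax
  rw [h.sum_eq] at h4
  rw [fib_block_unique h1 h2 h3 h4]
  exact ⟨hmem, hmax⟩

theorem isLazyFibRep_insert {m k : ℕ} {S : Finset ℕ} (hk : 2 ≤ k)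
    (h1 : Nat.fib (k + 1) ≤ m + 1) (h2 : m + 2 ≤ Nat.fib (k + 2))
    (h : IsLazyFibRep (m - Nat.fib k) S) : k ∉ S ∧ IsLazyFibRep m (insert k S) := by
  obtain ⟨n, rfl⟩ : ∃ n, k = n + 1 := ⟨k - 1, by omega⟩
  have e1 : Nat.fib (n + 1 + 1) = Nat.fib n + Nat.fib (n + 1) := Nat.fib_add_two
  have e2 : Nat.fib (n + 1 + 2) = Nat.fib (n + 1) + Nat.fib (n + 1 + 1) := Nat.fib_add_two
  have p1 : 0 < Nat.fib n := Nat.fib_pos.2 (by omega)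
  have hlt : ∀ t ∈ S, t < n + 1 := by
    intro t ht
    by_contra! hle
    have hmax : ∀ u ∈ S, u ≤ S.max' ⟨t, ht⟩ := fun u hu => S.le_max' u hu
    have := h.fib_succ_le _ (S.max'_mem ⟨t, ht⟩) hmax
    have := Nat.fib_mono (show n + 1 + 1 ≤ S.max' ⟨t, ht⟩ + 1 by have := hmax t ht; omega)
    omega
  have hnot : n + 1 ∉ S := fun hh => lt_irrefl _ (hlt _ hh)
  refine ⟨hnot, ⟨?_, ?_, ?_⟩⟩
  · intro t ht
    rcases Finset.mem_insert.1 ht with rfl | ht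
    · exact hk
    · exact h.two_le t ht
  · rw [Finset.sum_insert hnot, h.sum_eq]
    omega
  · rintro i hi ⟨t, ht, hit⟩
    simp only [Finset.mem_insert]
    by_cases hex : ∃ t ∈ S, i + 1 ≤ t
    · rcases h.no_two_zeros i hi hex with h | h
      · exact Or.inl (Or.inr h)
      · exact Or.inr (Or.inr h)
    · push Not at hex
      rcases Finset.mem_insert.1 ht with rfl | ht
      · rcases hit.eq_or_lt with h3 | h3
        · exact Or.inr (Or.inl h3)
        · by_cases hiS : i ∈ S
          · exact Or.inl (Or.inr hiS)
          -- Zeros at i and i + 1 would leave a sum of at most F_{i+1} - 2, but the remainder m -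
          -- F_k is at least F_{k-1} - 1.
          · have h4 := sum_fib_add_two_le h.two_le (i - 1) (by omega) fun t ht => by
              have := hex t ht
              have : t ≠ i := fun hh => hiS (hh ▸ ht)
              omega
            rw [h.sum_eq, show i - 1 + 2 = i + 1 by omega] at h4
            have := Nat.fib_mono (show i + 1 ≤ n by omega)
            omega
      · exact absurd hit (by have := hex t ht; omega)

theorem isLazyFibRep_zero_iff {S : Finset ℕ} : IsLazyFibRep 0 S ↔ S = ∅ := by
  constructor
  · intro h
    by_contra hne
    obtain ⟨t, ht⟩ := Finset.nonempty_iff_ne_empty.2 hne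
    have h1 := Finset.sum_eq_zero_iff.1 h.sum_eq t ht
    have := Nat.fib_pos.2 (show 0 < t by have := h.two_le t ht; omega)
    omega
  · rintro rfl
    exact ⟨by simp, by simp, by simp⟩

theorem existsUnique_isLazyFibRep (n : ℕ) : ∃! S : Finset ℕ, IsLazyFibRep n S := by
  induction n using Nat.strong_induction_on with
  | _ n ih =>
    rcases Nat.eq_zero_or_pos n with rfl | hn
    · exact ⟨∅, isLazyFibRep_zero_iff.2 rfl, fun S h => isLazyFibRep_zero_iff.1 h⟩
    · obtain ⟨k, hk, h1, h2⟩ := exists_fib_block hn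
      have hpos : 0 < Nat.fib k := Nat.fib_pos.2 (by omega)
      obtain ⟨S, hS, huniq⟩ := ih (n - Nat.fib k) (by omega)
      obtain ⟨hnot, hins⟩ := isLazyFibRep_insert hk h1 h2 hS
      refine ⟨insert k S, hins, fun T hT => ?_⟩
      obtain ⟨hkT, hmax⟩ := hT.mem_and_le_of_fib_block hk h1 h2
      rw [← huniq _ (hT.erase_max hkT hmax), Finset.insert_erase hkT]

theorem wordPeriods_fibonacciPrefix_zero : wordPeriods (fibonacciPrefix 0) = ∅ := by
  ext p
  rw [mem_wordPeriods_fibonacciPrefix]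
  simp only [Set.mem_empty_iff_false, iff_false]
  omega

theorem IsLazyFibRep.wordPeriods_eq (n : ℕ) : ∀ {S : Finset ℕ}, IsLazyFibRep n S →
    wordPeriods (fibonacciPrefix n) = {p | ∃ s ∈ S, p = ∑ t ∈ S with s ≤ t, Nat.fib t} := by
  induction n using Nat.strong_induction_on with
  | _ n ih =>
    intro S h
    rcases Nat.eq_zero_or_pos n with rfl | hn
    · rw [isLazyFibRep_zero_iff.1 h, wordPeriods_fibonacciPrefix_zero]
      simp
    · obtain ⟨k, hk, h1, h2⟩ := exists_fib_block hn
      have hpos : 0 < Nat.fib k := Nat.fib_pos.2 (by omega)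
      obtain ⟨hkS, hmax⟩ := h.mem_and_le_of_fib_block hk h1 h2
      rw [wordPeriods_fibonacciPrefix_eq_insert (isLeast_wordPeriods_fibonacciPrefix hk h1 h2),
        ih (n - Nat.fib k) (by omega) (h.erase_max hkS hmax)]
      have htop : ∑ t ∈ S with k ≤ t, Nat.fib t = Nat.fib k := by
        rw [show S.filter (k ≤ ·) = {k} by
          ext t
          simp only [Finset.mem_filter, Finset.mem_singleton]
          exact ⟨fun ht => le_antisymm (hmax t ht.1) ht.2, by rintro rfl; exact ⟨hkS, le_rfl⟩⟩]
        simp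
      have hrest : ∀ s ∈ S, ∑ t ∈ S with s ≤ t, Nat.fib t =
          Nat.fib k + ∑ t ∈ S.erase k with s ≤ t, Nat.fib t := by
        intro s hs
        rw [Finset.filter_erase, Finset.add_sum_erase]
        exact Finset.mem_filter.2 ⟨hkS, hmax s hs⟩
      ext p
      simp only [Set.mem_insert_iff, Set.mem_image, Set.mem_ofPred_eq]
      constructor
      · rintro (rfl | ⟨_, ⟨s, hs, rfl⟩, rfl⟩)
        · exact ⟨k, hkS, htop.symm⟩
        · have hsS := Finset.mem_of_mem_erase hs
          exact ⟨s, hsS, (hrest s hsS).symm⟩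
      · rintro ⟨s, hs, rfl⟩
        by_cases hsk : s = k
        · exact Or.inl (hsk ▸ htop)
        · exact Or.inr ⟨_, ⟨s, Finset.mem_erase.2 ⟨hsk, hs⟩, rfl⟩, (hrest s hs).symm⟩

/-! ### Counting periods. -/

theorem ncard_wordPeriods_fibonacciPrefix {k m : ℕ} (hk : 2 ≤ k)
    (h1 : Nat.fib (k + 1) ≤ m + 1) (h2 : m + 2 ≤ Nat.fib (k + 2)) :
    (wordPeriods (fibonacciPrefix m)).ncard =
      (wordPeriods (fibonacciPrefix (m - Nat.fib k))).ncard + 1 := by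
  have hfin : ∀ r, (wordPeriods (fibonacciPrefix r)).Finite := fun r =>
    (Set.finite_Iic r).subset fun p hp => (mem_wordPeriods_fibonacciPrefix.1 hp).2.1
  rw [wordPeriods_fibonacciPrefix_eq_insert (isLeast_wordPeriods_fibonacciPrefix hk h1 h2),
    Set.ncard_insert_of_notMem _ ((hfin _).image _),
    Set.ncard_image_of_injective _ (add_right_injective _)]
  rintro ⟨p, hp, hpk⟩
  have := (mem_wordPeriods_fibonacciPrefix.1 hp).1
  simp only at hpk
  omega

theorem ncard_wordPeriods_of_add_two_eq_fib (n : ℕ) : ∀ {m : ℕ}, m + 2 = Nat.fib (n + 3) →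
    (wordPeriods (fibonacciPrefix m)).ncard = n := by
  induction n with
  | zero =>
    intro m hm
    obtain rfl : m = 0 := by
      change m + 2 = 2 at hm
      omega
    simp [wordPeriods_fibonacciPrefix_zero]
  | succ n ih =>
    intro m hm
    have e1 : Nat.fib (n + 1 + 3) = Nat.fib (n + 2) + Nat.fib (n + 3) := Nat.fib_add_two
    have e2 : Nat.fib (n + 3) = Nat.fib (n + 1) + Nat.fib (n + 2) := Nat.fib_add_two
    have p1 : 0 < Nat.fib (n + 1) := Nat.fib_pos.2 (by omega)
    have p2 : 0 < Nat.fib (n + 2) := Nat.fib_pos.2 (by omega)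
    have := Nat.fib_mono (show 3 ≤ n + 3 by omega)
    rw [show Nat.fib 3 = 2 from rfl] at this
    rw [ncard_wordPeriods_fibonacciPrefix (k := n + 2) (by omega)
      (by change Nat.fib (n + 3) ≤ _; omega) (by change _ ≤ Nat.fib (n + 1 + 3); omega),
      ih (by omega)]

theorem ncard_wordPeriods_lt_of_add_two_lt_fib (n : ℕ) : ∀ {m : ℕ}, m + 2 < Nat.fib (n + 3) →
    (wordPeriods (fibonacciPrefix m)).ncard < n := by
  induction n with
  | zero =>
    intro m hm
    change m + 2 < 2 at hm
    omega
  | succ n ih =>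
    intro m hm
    have e1 : Nat.fib (n + 1 + 3) = Nat.fib (n + 2) + Nat.fib (n + 3) := Nat.fib_add_two
    rcases lt_trichotomy (m + 2) (Nat.fib (n + 3)) with h | h | h
    · exact (ih h).trans (Nat.lt_succ_self n)
    · rw [ncard_wordPeriods_of_add_two_eq_fib n h]
      exact Nat.lt_succ_self n
    · have := Nat.fib_mono (show 3 ≤ n + 3 by omega)
      rw [show Nat.fib 3 = 2 from rfl] at this
      have e2 : Nat.fib (n + 3) = Nat.fib (n + 1) + Nat.fib (n + 2) := Nat.fib_add_two
      have p1 : 0 < Nat.fib (n + 1) := Nat.fib_pos.2 (by omega)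
      rw [ncard_wordPeriods_fibonacciPrefix (k := n + 2) (by omega)
        (by change Nat.fib (n + 3) ≤ _; omega) (by change _ ≤ Nat.fib (n + 1 + 3); omega)]
      have := ih (m := m - Nat.fib (n + 2)) (by omega)
      omega

theorem ncard_wordPeriods_of_add_one_eq_fib (n : ℕ) : ∀ {m : ℕ}, m + 1 = Nat.fib (2 * n + 2) →
    (wordPeriods (fibonacciPrefix m)).ncard = n := by
  induction n with
  | zero =>
    intro m hm
    obtain rfl : m = 0 := by simpa using hm
    simp [wordPeriods_fibonacciPrefix_zero]
  | succ n ih =>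
    intro m hm
    change _ = Nat.fib (2 * n + 4) at hm
    have e1 : Nat.fib (2 * n + 4) = Nat.fib (2 * n + 2) + Nat.fib (2 * n + 3) := Nat.fib_add_two
    have e2 : Nat.fib (2 * n + 5) = Nat.fib (2 * n + 3) + Nat.fib (2 * n + 4) := Nat.fib_add_two
    have p1 : 0 < Nat.fib (2 * n + 2) := Nat.fib_pos.2 (by omega)
    have p2 : 0 < Nat.fib (2 * n + 3) := Nat.fib_pos.2 (by omega)
    rw [ncard_wordPeriods_fibonacciPrefix (k := 2 * n + 3) (by omega)
      (by change Nat.fib (2 * n + 4) ≤ _; omega) (by change _ ≤ Nat.fib (2 * n + 5); omega),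
      ih (by omega)]

/-- Removing the least period F_k keeps m - F_k ≥ F_{2n+2}: directly if k = 2n + 3, and for larger k
because m - F_k ≥ F_{k-1} - 1. -/
theorem lt_ncard_wordPeriods_of_fib_le (n : ℕ) : ∀ {m : ℕ}, Nat.fib (2 * n + 2) ≤ m →
    n < (wordPeriods (fibonacciPrefix m)).ncard := by
  induction n with
  | zero =>
    intro m hm
    obtain ⟨k, hk, h1, h2⟩ := exists_fib_block (show 1 ≤ m by simpa using hm)
    rw [ncard_wordPeriods_fibonacciPrefix hk h1 h2]
    exact Nat.succ_pos _
  | succ n ih =>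
    intro m hm
    change Nat.fib (2 * n + 4) ≤ m at hm
    have p0 : 0 < Nat.fib (2 * n + 4) := Nat.fib_pos.2 (by omega)
    obtain ⟨k, hk, h1, h2⟩ := exists_fib_block (show 1 ≤ m by omega)
    have hk3 : 2 * n + 3 ≤ k := by
      by_contra! hlt
      have := Nat.fib_mono (show k + 2 ≤ 2 * n + 4 by omega)
      omega
    rw [ncard_wordPeriods_fibonacciPrefix hk h1 h2]
    refine Nat.succ_lt_succ (ih ?_)
    have e1 : Nat.fib (2 * n + 4) = Nat.fib (2 * n + 2) + Nat.fib (2 * n + 3) := Nat.fib_add_two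
    rcases hk3.eq_or_lt with rfl | hk4
    · omega
    · have e2 : Nat.fib (2 * n + 3) = Nat.fib (2 * n + 1) + Nat.fib (2 * n + 2) := Nat.fib_add_two
      have p1 : 0 < Nat.fib (2 * n + 1) := Nat.fib_pos.2 (by omega)
      obtain ⟨l, rfl⟩ : ∃ l, k = l + 1 := ⟨k - 1, by omega⟩
      have e3 : Nat.fib (l + 1 + 1) = Nat.fib l + Nat.fib (l + 1) := Nat.fib_add_two
      have := Nat.fib_mono (show 2 * n + 3 ≤ l by omega)
      omega

theorem corollary11 :
    -- (a) the lazy representation exists and is unique, and its partial sums, from the top down,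
    -- are the periods of the length-`n` prefix
    (∀ n : ℕ, 1 ≤ n →
      (∃! S : Finset ℕ, IsLazyFibRep n S) ∧
      ∀ S : Finset ℕ, IsLazyFibRep n S →
        wordPeriods (fibonacciPrefix n) =
          {p | ∃ s ∈ S, p = ∑ t ∈ S with s ≤ t, Nat.fib t}) ∧
    -- (b) the shortest prefix with exactly `n` periods
    (∀ n : ℕ, 1 ≤ n →
      IsLeast {m : ℕ | (wordPeriods (fibonacciPrefix m)).ncard = n} (Nat.fib (n + 3) - 2)) ∧
    -- (c) the longest prefix with exactly `n` periods
    (∀ n : ℕ, 1 ≤ n →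
      IsGreatest {m : ℕ | (wordPeriods (fibonacciPrefix m)).ncard = n}
        (Nat.fib (2 * n + 2) - 1)) ∧
    -- (d) the least period of `f[0..m-1]`
    (∀ n m : ℕ, 2 ≤ n → Nat.fib (n + 1) - 1 ≤ m → m ≤ Nat.fib (n + 2) - 2 →
      IsLeast (wordPeriods (fibonacciPrefix m)) (Nat.fib n)) := by
  refine ⟨fun n _ => ⟨existsUnique_isLazyFibRep n, fun S hS => hS.wordPeriods_eq n⟩,
    fun n _ => ⟨?_, fun m hm => ?_⟩, fun n _ => ⟨?_, fun m hm => ?_⟩, fun n m hn h1 h2 => ?_⟩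
  · refine ncard_wordPeriods_of_add_two_eq_fib n ?_
    have := Nat.fib_mono (show 3 ≤ n + 3 by omega)
    rw [show Nat.fib 3 = 2 from rfl] at this
    omega
  · by_contra! hlt
    exact (ncard_wordPeriods_lt_of_add_two_lt_fib n (m := m) (by omega)).ne hm
  · refine ncard_wordPeriods_of_add_one_eq_fib n ?_
    have := Nat.fib_pos.2 (show 0 < 2 * n + 2 by omega)
    omega
  · by_contra! hlt
    exact (lt_ncard_wordPeriods_of_fib_le n (m := m) (by omega)).ne' hm
  · have := Nat.fib_mono (show 3 ≤ n + 2 by omega)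
    rw [show Nat.fib 3 = 2 from rfl] at this
    exact isLeast_wordPeriods_fibonacciPrefix hn (by omega) (by omega)
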